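/- Let $m\in\mathbb N$, let $T=\{t_1,\dots,t_m\}$ be a set of transitions, and let $\Upsilon\in\mathbb N^{T}$ be a prime T-vector with support $T$, i.e. $\Upsilon(t_i)\ge 1$ for all $i$ and $\gcd(\Upsilon(t_1),\dots,\Upsilon(t_m))=1$. Consider the following algorithm with input $\Upsilon$. (1) Start with no place. For each pair of distinct labels $t_i,t_j$ (in any order), add two places $p_{i,j}$ and $p_{j,i}$ whose only arcs have the weights $$W(p_{i,j},t_j)=W(t_j,p_{j,i})=\frac{\Upsilon(t_i)}{\gcd(\Upsilon(t_i),\Upsilon(t_j))},\qquad W(p_{j,i},t_i)=W(t_i,p_{i,j})=\frac{\Upsilon(t_j)}{\gcd(\Upsilon(t_i),\Upsilon(t_j))}.$$ (2) For $i=2,\dots,m$: for each $h<i$, set $M_0(p_{i,h})=W(p_{i,h},t_h)$; then for each $h<i$, set $M_0(p_{h,i})=W(p_{h,i},t_i)-\gcd_{p_{h,i}}$, where $\gcd_p$ is the greatest common divisor of all input and output weights of $p$. (3) Return the system $\mathcal S=((P,T,W),M_0)$. Theorem (weak synthesis of a WMG). The algorithm terminates. In the system $\mathcal S$ that it returns,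 the places are exactly the $p_{i,j}$ with $i\ne j$, the weights are those of (1) (all other weights being $0$), and $M_0(p_{i,j})=W(p_{i,j},t_j)$ if $j<i$ and $M_0(p_{i,j})=W(p_{i,j},t_j)-1$ if $i<j$. Moreover: - $\mathcal S$ is a weighted marked graph, i.e. each place has at most one input transition and at most one output transition; - $\mathcal S$ is live, i.e. for every reachable marking $M$ and every $t\in T$, a marking enabling $t$ is reachable from $M$; - every reachable marking enables exactly one transition; - the reachability graph of $\mathcal S$ is a circle, i.e. it is finite and strongly connected and contains a unique cycle (a cycle being a closed path without repeated state, taken up to rotation); - $\mathcal S$ cyclically solves some nonempty word $w=w_1\cdots w_k\in T^*$ whose Parikh vector $\mathbf P(w)$ (counting the occurrences of each label) equals $\Upsilon$, i.e. the reachability graph of $\mathcal S$ is isomorphic, as a labelled transition system with initial state, to the circular labelled transition system $s_0[w_1\rangle s_1[w_2\rangle s_2\cdots[w_k\rangle s_0$ with initial state $s_0$. -/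

import Mathlib

namespace WeakSynthesis

/-! ### Labelled transition systems -/

/-- A labelled transition system with state type `S`, label type `T` and an initial state. -/
structure LTS (S T : Type) where
  tr : S → T → S → Prop
  init : S

namespace LTS

variable {S S' T : Type}

/-- `TS.Path s σ s'`: the sequence `σ` is enabled at `s` and leads to `s'`. -/
inductive Path (TS : LTS S T) : S → List T → S → Prop
  | nil (s : S) : Path TS s [] s
  | snoc {s s' s'' : S} {σ : List T} {t : T} :
      Path TS s σ s' → TS.tr s' t s'' → Path TS s (σ ++ [t]) s''

/-- `s'` is reachable from `s`. -/
def Reachable (TS : LTS S T) (s s' : S) : Prop := ∃ σ : List T, TS.Path s σ s'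

/-- The label `t` is enabled at the state `s`. -/
def Enabled (TS : LTS S T) (s : S) (t : T) : Prop := ∃ s', TS.tr s t s'

/-- Isomorphism of labelled transition systems over the same labels. -/
def Isomorphic (TS : LTS S T) (TS' : LTS S' T) : Prop :=
  ∃ ζ : S ≃ S', ζ TS.init = TS'.init ∧
    ∀ s t s', TS.tr s t s' ↔ TS'.tr (ζ s) t (ζ s')

/-- A cycle of the underlying graph: a nonempty cyclic sequence of arcs, considered up to
rotation, in which each arc ends where the next one starts and no state is visited twice. -/
def IsGraphCycle (TS : LTS S T) (c : Cycle (S × T × S)) : Prop :=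
  c ≠ Cycle.nil ∧ (∀ e ∈ c, TS.tr e.1 e.2.1 e.2.2) ∧
    c.Chain (fun e f => e.2.2 = f.1) ∧ (c.map Prod.fst).Nodup

/-- A circular transition system: finite, strongly connected, with a unique cycle. -/
def IsCircular (TS : LTS S T) : Prop :=
  Finite S ∧ (∀ s s', TS.Reachable s s') ∧ ∃! c, TS.IsGraphCycle c

end LTS

/-- The circular transition system `s₀ [w₁⟩ s₁ [w₂⟩ s₂ … [w_k⟩ s₀` induced by a nonempty word. -/
def circularLTS {T : Type} (w : List T) (hw : w ≠ []) : LTS (Fin w.length) T where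
  tr i t j := t = w.get i ∧ (j : ℕ) = ((i : ℕ) + 1) % w.length
  init := ⟨0, List.length_pos_of_ne_nil hw⟩

/-- The Parikh vector of a word. -/
def parikh {T : Type} [DecidableEq T] (w : List T) (t : T) : ℕ := w.count t

/-! ### Weighted Petri nets -/

/-- A weighted net with an initial marking; `pre p t` is the weight `W(p,t)` and
`post p t` is the weight `W(t,p)`. -/
structure PetriSystem (P T : Type) where
  pre : P → T → ℕ
  post : P → T → ℕ
  M₀ : P → ℕ

namespace PetriSystem

variable {P T : Type}

/-- The transition `t` is enabled by the marking `M`. -/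
def Enabled (N : PetriSystem P T) (M : P → ℕ) (t : T) : Prop := ∀ p, N.pre p t ≤ M p

/-- Firing of `t` leads from `M` to `M'`. -/
def Fires (N : PetriSystem P T) (M : P → ℕ) (t : T) (M' : P → ℕ) : Prop :=
  N.Enabled M t ∧ ∀ p, M' p = M p - N.pre p t + N.post p t

/-- The transition system of all markings under the firing rule. -/
def markingLTS (N : PetriSystem P T) : LTS (P → ℕ) T where
  tr := N.Fires
  init := N.M₀

/-- The marking `M'` is reachable from the marking `M`. -/
def ReachableFrom (N : PetriSystem P T) (M M' : P → ℕ) : Prop := N.markingLTS.Reachable M M'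

/-- The reachability graph, on the markings reachable from the initial one. -/
def reachabilityGraph (N : PetriSystem P T) : LTS {M : P → ℕ // N.ReachableFrom N.M₀ M} T where
  tr M t M' := N.Fires M.1 t M'.1
  init := ⟨N.M₀, [], LTS.Path.nil _⟩

/-- Liveness: from every reachable marking, for every transition `t`, one can reach a marking
that enables `t`. -/
def Live (N : PetriSystem P T) : Prop :=
  ∀ M, N.ReachableFrom N.M₀ M → ∀ t, ∃ M', N.ReachableFrom M M' ∧ N.Enabled M' t

/-- Weighted marked graphs: every place has at most one output and at most one input
transition. -/
def IsWMG (N : PetriSystem P T) : Prop :=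
  ∀ p, {t | 0 < N.pre p t}.encard ≤ 1 ∧ {t | 0 < N.post p t}.encard ≤ 1

/-- The system cyclically solves the nonempty word `w`. -/
def CyclicallySolves (N : PetriSystem P T) (w : List T) (hw : w ≠ []) : Prop :=
  (circularLTS w hw).Isomorphic N.reachabilityGraph

end PetriSystem

/-! ### The weak synthesis algorithm

The labels are `t₁, …, t_m`, represented by `Fin m` (so `t_i` is the element `i - 1`);
the place `p_{i,j}` is represented by the pair `(i, j)`. -/

/-- A `T`-vector is prime if the greatest common divisor of its components is one. -/
def IsPrimeVector {m : ℕ} (Υ : Fin m → ℕ) : Prop := Finset.univ.gcd Υ = 1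

/-- The data manipulated by the algorithm: a net under construction, and its marking. -/
structure Memory (m : ℕ) where
  places : Finset (Fin m × Fin m)
  pre : Fin m × Fin m → Fin m → ℕ
  post : Fin m × Fin m → Fin m → ℕ
  marking : Fin m × Fin m → ℕ

namespace Memory

variable {m : ℕ}

/-- No place, no arc, no token. -/
def empty (m : ℕ) : Memory m := ⟨∅, 0, 0, 0⟩

/-- Add the places `p_{i,j}` and `p_{j,i}` with
`W(p_{i,j}, t_j) = W(t_j, p_{j,i}) = Υ(t_i) / gcd(Υ(t_i), Υ(t_j))` and
`W(p_{j,i}, t_i) = W(t_i, p_{i,j}) = Υ(t_j) / gcd(Υ(t_i), Υ(t_j))`. -/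
def addCircuit (Υ : Fin m → ℕ) (i j : Fin m) (s : Memory m) : Memory m where
  places := insert (i, j) (insert (j, i) s.places)
  pre := Function.update
    (Function.update s.pre (i, j) (Pi.single j (Υ i / Nat.gcd (Υ i) (Υ j))))
    (j, i) (Pi.single i (Υ j / Nat.gcd (Υ i) (Υ j)))
  post := Function.update
    (Function.update s.post (j, i) (Pi.single j (Υ i / Nat.gcd (Υ i) (Υ j))))
    (i, j) (Pi.single i (Υ j / Nat.gcd (Υ i) (Υ j)))
  marking := s.marking

/-- The gcd of all input and output weights of the place `p`. -/
def placeGcd (s : Memory m) (p : Fin m × Fin m) : ℕ :=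
  Finset.univ.gcd fun t => Nat.gcd (s.pre p t) (s.post p t)

/-- The assignment `M₀(p) := k`. -/
def setMarking (p : Fin m × Fin m) (k : ℕ) (s : Memory m) : Memory m :=
  { s with marking := Function.update s.marking p k }

/-- The marked net stored in the memory. -/
def toSystem (s : Memory m) : PetriSystem s.places (Fin m) where
  pre p := s.pre p
  post p := s.post p
  M₀ p := s.marking p

end Memory

/-- Control points of the algorithm. -/
inductive Control (m : ℕ)
  /-- the first loop, with the pairs of distinct labels that are still to be visited -/
  | build (todo : Finset (Fin m × Fin m))
  /-- the head of the second loop, with the value of its counter (counted from `0`) -/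
  | head (i : ℕ)
  /-- marking the outputs `p_{i,h}` of `t_i`, with the indices `h < i` still to be treated -/
  | markOut (i : Fin m) (todo : Finset (Fin m))
  /-- marking the inputs `p_{h,i}` of `t_i`, with the indices `h < i` still to be treated -/
  | markIn (i : Fin m) (todo : Finset (Fin m))
  /-- the algorithm has returned the stored system -/
  | done

/-- One elementary step of the algorithm on input `Υ`. Where the algorithm says `for each`
without fixing an order, every order is allowed. -/
inductive Step {m : ℕ} (Υ : Fin m → ℕ) :
    Control m × Memory m → Control m × Memory m → Prop
  | addPair {todo : Finset (Fin m × Fin m)} {i j : Fin m} {s : Memory m} :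
      (i, j) ∈ todo →
      Step Υ (.build todo, s) (.build (todo.erase (i, j)), s.addCircuit Υ i j)
  | endBuild {s : Memory m} : Step Υ (.build ∅, s) (.head 1, s)
  | enter {i : ℕ} {s : Memory m} (hi : i < m) :
      Step Υ (.head i, s) (.markOut ⟨i, hi⟩ (Finset.univ.filter (· < ⟨i, hi⟩)), s)
  | markOutput {i h : Fin m} {todo : Finset (Fin m)} {s : Memory m} :
      h ∈ todo →
      Step Υ (.markOut i todo, s)
        (.markOut i (todo.erase h), s.setMarking (i, h) (s.pre (i, h) h))
  | endOutputs {i : Fin m} {s : Memory m} :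
      Step Υ (.markOut i ∅, s) (.markIn i (Finset.univ.filter (· < i)), s)
  | markInput {i h : Fin m} {todo : Finset (Fin m)} {s : Memory m} :
      h ∈ todo →
      Step Υ (.markIn i todo, s)
        (.markIn i (todo.erase h),
          s.setMarking (h, i) (s.pre (h, i) i - s.placeGcd (h, i)))
  | endInputs {i : Fin m} {s : Memory m} :
      Step Υ (.markIn i ∅, s) (.head ((i : ℕ) + 1), s)
  | exit {i : ℕ} {s : Memory m} : m ≤ i → Step Υ (.head i, s) (.done, s)

/-- The start of the algorithm: nothing has been built, and every unordered pair of distinct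
labels, represented by `(i, j)` with `i < j`, is to be visited. -/
def start (m : ℕ) : Control m × Memory m :=
  (.build (Finset.univ.filter fun q => q.1 < q.2), Memory.empty m)

/-- The algorithm terminates on input `Υ`: there is no infinite execution, and an execution
that cannot be continued has reached the `return` statement. -/
def Terminates {m : ℕ} (Υ : Fin m → ℕ) : Prop :=
  (¬ ∃ run : ℕ → Control m × Memory m, run 0 = start m ∧ ∀ n, Step Υ (run n) (run (n + 1))) ∧
  ∀ c, Relation.ReflTransGen (Step Υ) (start m) c → (∀ c', ¬ Step Υ c c') → c.1 = .done

/-- Some execution of the algorithm on input `Υ` returns the system stored in `s`. -/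
def Returns {m : ℕ} (Υ : Fin m → ℕ) (s : Memory m) : Prop :=
  Relation.ReflTransGen (Step Υ) (start m) (.done, s)

/-- The stored system is the complete net of all binary circuits, with the prescribed weights
and initial marking. -/
def IsCompleteNet {m : ℕ} (Υ : Fin m → ℕ) (s : Memory m) : Prop :=
  (∀ i j, (i, j) ∈ s.places ↔ i ≠ j) ∧
  ∀ i j, i ≠ j →
    (∀ t, s.pre (i, j) t = if t = j then Υ i / Nat.gcd (Υ i) (Υ j) else 0) ∧
    (∀ t, s.post (i, j) t = if t = i then Υ j / Nat.gcd (Υ i) (Υ j) else 0) ∧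
    (j < i → s.marking (i, j) = s.pre (i, j) j) ∧
    (i < j → s.marking (i, j) + 1 = s.pre (i, j) j)

end WeakSynthesis

/-! In the returned net, the place between `i` and `j` only records how `σ.count i / Υ i` compares
with `σ.count j / Υ j`, where `σ` is the sequence fired so far. The initial marking, full for one
place of each pair and one token short for the other, breaks ties in favour of the smaller index. So
`j` is enabled exactly when it minimises the pair (ratio, index) lexicographically (`enabled_iff`).
A lexicographic minimum exists and is unique, so every reachable marking enables exactly one
transition.

The reachability graph is therefore the orbit of the initial marking under a function `f`, and
everything reduces to the minimal period of that orbit, which is `∑ t, Υ t`. The fair choice of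
transitions keeps every count at most `Υ t` for that many steps (`count_le`), so the counts are then
exactly `Υ` and the initial marking recurs. Conversely, a return to the initial marking forces
counts proportional to `Υ`, and primality makes the length a multiple of the sum (`sum_dvd_length`).

For the algorithm, a decreasing rank gives termination, and an invariant at each control point,
independent of the order of visits, describes the result. -/

namespace WeakSynthesis

/-! ### Deterministic transition systems and periodic orbits -/

namespace LTS

variable {S T : Type}

/-- Every state `s` has a single outgoing arc, with label `l s` and target `f s`. -/
def IsDeterminedBy (TS : LTS S T) (l : S → T) (f : S → S) : Prop :=
  ∀ s t s', TS.tr s t s' ↔ t = l s ∧ s' = f s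

/-- The labels of the first `n` arcs followed from `s`. -/
def trace (l : S → T) (f : S → S) (s : S) (n : ℕ) : List T :=
  (List.range n).map fun k => l (f^[k] s)

@[simp]
theorem length_trace (l : S → T) (f : S → S) (s : S) (n : ℕ) : (trace l f s n).length = n := by
  simp [trace]

theorem getElem_trace (l : S → T) (f : S → S) (s : S) (n : ℕ) {k : ℕ}
    (hk : k < (trace l f s n).length) : (trace l f s n)[k] = l (f^[k] s) := by
  simp [trace]

namespace IsDeterminedBy

variable {TS : LTS S T} {l : S → T} {f : S → S}

theorem path_trace (h : TS.IsDeterminedBy l f) (s : S) (n : ℕ) :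
    TS.Path s (trace l f s n) (f^[n] s) := by
  induction n with
  | zero => exact Path.nil s
  | succ n ih =>
    have : trace l f s (n + 1) = trace l f s n ++ [l (f^[n] s)] := by
      simp [trace, List.range_succ]
    rw [this]
    exact ih.snoc ((h _ _ _).2 ⟨rfl, Function.iterate_succ_apply' f n s⟩)

theorem eq_iterate_of_path (h : TS.IsDeterminedBy l f) {s s' : S} {σ : List T}
    (hp : TS.Path s σ s') : s' = f^[σ.length] s := by
  induction hp with
  | nil => rfl
  | snoc _ htr ih =>
    rw [List.length_append, List.length_singleton, Function.iterate_succ_apply', ← ih]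
    exact ((h _ _ _).1 htr).2

theorem exists_iterate_eq (h : TS.IsDeterminedBy l f) {s s' : S} (hr : TS.Reachable s s') :
    ∃ n, f^[n] s = s' := by
  obtain ⟨σ, hσ⟩ := hr
  exact ⟨_, (h.eq_iterate_of_path hσ).symm⟩

theorem reachable_iterate (h : TS.IsDeterminedBy l f) (s : S) (n : ℕ) :
    TS.Reachable s (f^[n] s) := ⟨_, h.path_trace s n⟩

theorem reachable_of_pos (h : TS.IsDeterminedBy l f) (hr : ∀ s, TS.Reachable TS.init s)
    (hpos : 0 < Function.minimalPeriod f TS.init) (s s' : S) : TS.Reachable s s' := by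
  obtain ⟨n, rfl⟩ := h.exists_iterate_eq (hr s)
  obtain ⟨n', rfl⟩ := h.exists_iterate_eq (hr s')
  set K := Function.minimalPeriod f TS.init
  -- `K * n` is a multiple of the period that is at least `n`: going on from step `n` up to it
  -- returns to the initial state.
  have hn : n ≤ K * n := Nat.le_mul_of_pos_left n hpos
  have key : f^[n' + (K * n - n)] (f^[n] TS.init) = f^[n'] TS.init := by
    rw [← Function.iterate_add_apply, add_assoc, Nat.sub_add_cancel hn,
      Function.iterate_add_apply]
    congr 1
    exact (Function.isPeriodicPt_minimalPeriod f TS.init).mul_const n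
  rw [← key]
  exact h.reachable_iterate _ _

theorem map_fst_eq_of_isChain (l : S → T) (f : S → S) (L : List (S × T × S)) (e : S × T × S)
    (hE : ∀ x ∈ e :: L, x = (x.1, l x.1, f x.1))
    (hc : List.IsChain (fun x y : S × T × S => x.2.2 = y.1) (e :: L)) :
    (e :: L).map Prod.fst = (List.range (L.length + 1)).map fun k => f^[k] e.1 := by
  induction L generalizing e with
  | nil => simp
  | cons e' L ih =>
    rw [List.isChain_cons_cons] at hc
    have he' : e'.1 = f e.1 := by
      rw [← hc.1, hE e (by simp)]
    rw [List.map_cons, ih e' (fun x hx => hE x (List.mem_cons_of_mem _ hx)) hc.2,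
      List.length_cons, List.range_succ_eq_map (n := L.length + 1), List.map_cons, List.map_map]
    simp [he', Function.comp_def]

/-- Each arc is determined by its source, so a closed chain follows `f`. Closure makes its length a
period, and the absence of repeated states makes that period minimal. -/
theorem map_fst_eq_periodicOrbit (h : TS.IsDeterminedBy l f) {c : Cycle (S × T × S)}
    (hc : TS.IsGraphCycle c) :
    ∃ s, s ∈ Function.periodicPts f ∧ c.map Prod.fst = Function.periodicOrbit f s := by
  obtain ⟨hne, htr, hch, hnd⟩ := hc
  induction c using Quotient.inductionOn with
  | _ L =>
  cases L with
  | nil => exact absurd rfl hne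
  | cons e L =>
  have hE : ∀ x ∈ e :: L, x = (x.1, l x.1, f x.1) := by
    intro x hx
    obtain ⟨h1, h2⟩ := (h _ _ _).1 (htr x hx)
    rw [← h1, ← h2]
  have hch' : List.IsChain (fun x y : S × T × S => x.2.2 = y.1) (e :: (L ++ [e])) :=
    Cycle.chain_coe_cons _ _ _ |>.1 hch
  -- With the first arc appended again, the last entry of this equation says that the chain closes
  -- up.
  have hmap := map_fst_eq_of_isChain l f (L ++ [e]) e
    (fun x hx => hE x (by simpa [or_comm, or_left_comm] using hx)) hch'
  rw [List.length_append, List.length_singleton, List.range_succ, List.map_append,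
    ← List.cons_append, List.map_append] at hmap
  obtain ⟨h1, h2⟩ := List.append_inj' hmap (by simp)
  have hper : f^[L.length + 1] e.1 = e.1 := by simpa using h2.symm
  have hmem : e.1 ∈ Function.periodicPts f := ⟨L.length + 1, by simp, hper⟩
  have hnd' : ((List.range (L.length + 1)).map fun k => f^[k] e.1).Nodup := by
    rw [← h1]; exact hnd
  have hle : L.length + 1 ≤ Function.minimalPeriod f e.1 := by
    by_contra hlt
    push Not at hlt
    have := List.inj_on_of_nodup_map hnd' (x := 0) (by simp)
      (y := Function.minimalPeriod f e.1) (by simpa using hlt)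
      (by simp [Function.iterate_minimalPeriod])
    exact (Function.minimalPeriod_pos_of_mem_periodicPts hmem).ne this
  have hK : Function.minimalPeriod f e.1 = L.length + 1 :=
    le_antisymm (Function.IsPeriodicPt.minimalPeriod_le (by simp) hper) hle
  refine ⟨e.1, hmem, ?_⟩
  rw [Function.periodicOrbit, hK, ← h1]
  rfl

/-- Any cycle is the orbit of some state. All states lie on the orbit of the initial one, so the
sources agree up to rotation, and the sources determine the arcs. -/
theorem isCircular (h : TS.IsDeterminedBy l f) (hr : ∀ s, TS.Reachable TS.init s)
    (hpos : 0 < Function.minimalPeriod f TS.init) : TS.IsCircular := by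
  have hmem : TS.init ∈ Function.periodicPts f :=
    Function.minimalPeriod_pos_iff_mem_periodicPts.1 hpos
  refine ⟨?_, h.reachable_of_pos hr hpos,
    (Function.periodicOrbit f TS.init).map fun s => (s, l s, f s), ⟨?_, ?_, ?_, ?_⟩, ?_⟩
  · refine Finite.of_surjective
      (fun i : Fin (Function.minimalPeriod f TS.init) => f^[i] TS.init) fun s => ?_
    obtain ⟨n, rfl⟩ := h.exists_iterate_eq (hr s)
    exact ⟨⟨n % _, Nat.mod_lt _ hpos⟩, Function.iterate_mod_minimalPeriod_eq⟩
  · intro hnil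
    have := congrArg Cycle.length hnil
    simp only [Function.periodicOrbit, Cycle.map_coe, Cycle.length_coe, List.length_map,
      List.length_range, Cycle.length_nil] at this
    omega
  · intro e he
    obtain ⟨s, -, rfl⟩ := Cycle.mem_map.1 he
    exact (h _ _ _).2 ⟨rfl, rfl⟩
  · rw [Cycle.chain_map, Function.periodicOrbit_chain' _ hmem]
    intro n
    exact (Function.iterate_succ_apply' f n _).symm
  · have : Cycle.map Prod.fst ((Function.periodicOrbit f TS.init).map fun s => (s, l s, f s)) =
        Function.periodicOrbit f TS.init := by
      simp [Function.periodicOrbit, Cycle.map_coe, List.map_map, Function.comp_def]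
    rw [this]
    exact Function.nodup_periodicOrbit
  · intro c hc
    obtain ⟨s, hs, hcs⟩ := h.map_fst_eq_periodicOrbit hc
    obtain ⟨n, rfl⟩ := h.exists_iterate_eq (hr s)
    rw [Function.periodicOrbit_apply_iterate_eq hmem] at hcs
    rw [← hcs]
    have htr := hc.2.1
    induction c using Quotient.inductionOn with
    | _ L =>
    refine congrArg (fun L : List (S × T × S) => (L : Cycle (S × T × S))) (?_ :
      L = List.map (fun s => (s, l s, f s)) (L.map Prod.fst))
    rw [List.map_map]
    refine (List.map_id' L).symm.trans (List.map_congr_left fun x hx => ?_)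
    obtain ⟨h1, h2⟩ := (h _ _ _).1 (htr x hx)
    simp only [Function.comp]
    rw [← h1, ← h2]

theorem isomorphic_circularLTS (h : TS.IsDeterminedBy l f) (hr : ∀ s, TS.Reachable TS.init s)
    {K : ℕ} (hK : Function.minimalPeriod f TS.init = K)
    (hw : trace l f TS.init K ≠ []) :
    (circularLTS (trace l f TS.init K) hw).Isomorphic TS := by
  have hlen : (trace l f TS.init K).length = K := length_trace _ _ _ _
  have hpos : 0 < K := hlen ▸ List.length_pos_of_ne_nil hw
  have hinj : ∀ a b, a < K → b < K → (f^[a] TS.init = f^[b] TS.init ↔ a = b) := fun a b ha hb =>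
    Function.iterate_eq_iterate_iff_of_lt_minimalPeriod (hK ▸ ha) (hK ▸ hb)
  have hbij : Function.Bijective
      fun i : Fin (trace l f TS.init K).length => f^[(i : ℕ)] TS.init := by
    constructor
    · intro a b hab
      exact Fin.ext ((hinj a b (by simpa using a.2) (by simpa using b.2)).1 hab)
    · intro s
      obtain ⟨n, rfl⟩ := h.exists_iterate_eq (hr s)
      refine ⟨⟨n % K, by rw [hlen]; exact Nat.mod_lt _ hpos⟩, ?_⟩
      subst hK
      exact Function.iterate_mod_minimalPeriod_eq
  refine ⟨Equiv.ofBijective _ hbij, rfl, fun i t j => ?_⟩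
  rw [h]
  simp only [circularLTS, Equiv.ofBijective_apply]
  have hget : (trace l f TS.init K).get i = l (f^[(i : ℕ)] TS.init) := getElem_trace _ _ _ _ i.2
  have hmodlen : ((i : ℕ) + 1) % (trace l f TS.init K).length = ((i : ℕ) + 1) % K :=
    congrArg (((i : ℕ) + 1) % ·) hlen
  rw [hget, ← Function.iterate_succ_apply' f]
  have hmod : f^[(i : ℕ) + 1] TS.init = f^[((i : ℕ) + 1) % K] TS.init := by
    subst hK
    exact Function.iterate_mod_minimalPeriod_eq.symm
  rw [Nat.succ_eq_add_one, hmodlen, hmod, hinj _ _ (by simpa using j.2) (Nat.mod_lt _ hpos)]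

end IsDeterminedBy

end LTS

end WeakSynthesis

/-! ### Termination and invariant of the algorithm -/

namespace WeakSynthesis

variable {m : ℕ}

/-- A bound on the number of steps that remain. -/
def Control.rank : Control m → ℕ
  | .build todo => m * (2 * m + 4) + 2 + todo.card
  | .head i => (m - i) * (2 * m + 4) + 1
  | .markOut i todo => (m - (i + 1)) * (2 * m + 4) + (todo.card + m + 3)
  | .markIn i todo => (m - (i + 1)) * (2 * m + 4) + (todo.card + 2)
  | .done => 0

/-- A pass through the second loop takes at most `2 * m + 3` steps, so the summand `2 * m + 4` for
each remaining pass pays for it. -/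
theorem Step.rank_lt {Υ : Fin m → ℕ} {c c' : Control m × Memory m} (h : Step Υ c c') :
    c'.1.rank < c.1.rank := by
  have hcard : ∀ s : Finset (Fin m), s.card ≤ m := fun s => by
    simpa using Finset.card_le_univ s
  cases h with
  | addPair h => have := Finset.card_erase_lt_of_mem h; simp only [Control.rank]; omega
  | endBuild =>
    have := Nat.mul_le_mul_right (2 * m + 4) (Nat.sub_le m 1)
    simp only [Control.rank, Finset.card_empty]; omega
  | @enter i s hi =>
    have h1 := hcard (Finset.univ.filter (· < (⟨i, hi⟩ : Fin m)))
    have h2 : m - i = (m - (i + 1)) + 1 := by omega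
    simp only [Control.rank, h2, add_mul]
    omega
  | markOutput h => have := Finset.card_erase_lt_of_mem h; simp only [Control.rank]; omega
  | @endOutputs i s =>
    have h1 := hcard (Finset.univ.filter (· < i))
    simp only [Control.rank, Finset.card_empty]; omega
  | markInput h => have := Finset.card_erase_lt_of_mem h; simp only [Control.rank]; omega
  | endInputs => simp only [Control.rank, Finset.card_empty]; omega
  | exit h => simp only [Control.rank]; omega

theorem exists_step_of_ne_done (Υ : Fin m → ℕ) (c : Control m × Memory m) (hc : c.1 ≠ .done) :
    ∃ c', Step Υ c c' := by
  obtain ⟨k, s⟩ := c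
  cases k with
  | build todo =>
    obtain rfl | ⟨⟨i, j⟩, h⟩ := todo.eq_empty_or_nonempty
    · exact ⟨_, .endBuild⟩
    · exact ⟨_, .addPair h⟩
  | head i =>
    obtain h | h := lt_or_ge i m
    · exact ⟨_, .enter h⟩
    · exact ⟨_, .exit h⟩
  | markOut i todo =>
    obtain rfl | ⟨j, h⟩ := todo.eq_empty_or_nonempty
    · exact ⟨_, .endOutputs⟩
    · exact ⟨_, .markOutput h⟩
  | markIn i todo =>
    obtain rfl | ⟨j, h⟩ := todo.eq_empty_or_nonempty
    · exact ⟨_, .endInputs⟩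
    · exact ⟨_, .markInput h⟩
  | done => exact absurd rfl hc

theorem terminates (Υ : Fin m → ℕ) : Terminates Υ := by
  refine ⟨?_, fun c _ hc => ?_⟩
  · rintro ⟨run, -, hrun⟩
    have key : ∀ n, (run n).1.rank + n ≤ (run 0).1.rank := by
      intro n
      induction n with
      | zero => simp
      | succ n ih => have := (hrun n).rank_lt; omega
    have := key ((run 0).1.rank + 1)
    omega
  · by_contra hne
    obtain ⟨c', h⟩ := exists_step_of_ne_done Υ c hne
    exact hc c' h

namespace Memory

/-- The arcs of the place `p_{i,j}` have the prescribed weights. -/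
def HasWeights (Υ : Fin m → ℕ) (s : Memory m) (i j : Fin m) : Prop :=
  s.pre (i, j) = Pi.single j (Υ i / Nat.gcd (Υ i) (Υ j)) ∧
    s.post (i, j) = Pi.single i (Υ j / Nat.gcd (Υ i) (Υ j))

/-- The memory holds exactly the places `p_{i,j}` with `i ≠ j`, with the prescribed weights. -/
def IsBuilt (Υ : Fin m → ℕ) (s : Memory m) : Prop :=
  (∀ i j, (i, j) ∈ s.places ↔ i ≠ j) ∧ ∀ i j, i ≠ j → s.HasWeights Υ i j

/-- The place `p_{i,j}` carries the prescribed number of tokens. -/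
def IsMarked (s : Memory m) (i j : Fin m) : Prop :=
  (j < i → s.marking (i, j) = s.pre (i, j) j) ∧
    (i < j → s.marking (i, j) + 1 = s.pre (i, j) j)

theorem hasWeights_addCircuit (Υ : Fin m → ℕ) (s : Memory m) {i j : Fin m} (hij : i ≠ j) :
    (s.addCircuit Υ i j).HasWeights Υ i j ∧ (s.addCircuit Υ i j).HasWeights Υ j i := by
  have h1 : ((i, j) : Fin m × Fin m) ≠ (j, i) := fun h => hij (congrArg Prod.fst h)
  simp [HasWeights, addCircuit, Function.update_of_ne h1, Function.update_of_ne h1.symm,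
    Nat.gcd_comm (Υ j) (Υ i)]

theorem HasWeights.addCircuit {Υ : Fin m → ℕ} {s : Memory m} {a b : Fin m}
    (h : s.HasWeights Υ a b) {i j : Fin m} (h1 : (a, b) ≠ (i, j)) (h2 : (a, b) ≠ (j, i)) :
    (s.addCircuit Υ i j).HasWeights Υ a b := by
  simpa only [HasWeights, Memory.addCircuit, Function.update_of_ne h1, Function.update_of_ne h2]
    using h

/-- The two weights of the place are coprime, being quotients by a gcd. Hence the algorithm
subtracts exactly one token. -/
theorem placeGcd_of_hasWeights {Υ : Fin m → ℕ} {s : Memory m} {i j : Fin m} (hij : i ≠ j)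
    (hpos : 0 < Υ i) (h : s.HasWeights Υ i j) : s.placeGcd (i, j) = 1 := by
  have hg : 0 < Nat.gcd (Υ i) (Υ j) := Nat.gcd_pos_of_pos_left _ hpos
  have hi : s.placeGcd (i, j) ∣ Υ j / Nat.gcd (Υ i) (Υ j) := by
    have := Finset.gcd_dvd (f := fun t => Nat.gcd (s.pre (i, j) t) (s.post (i, j) t))
      (Finset.mem_univ i)
    simpa [placeGcd, h.1, h.2, Pi.single_eq_of_ne hij] using this
  have hj : s.placeGcd (i, j) ∣ Υ i / Nat.gcd (Υ i) (Υ j) := by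
    have := Finset.gcd_dvd (f := fun t => Nat.gcd (s.pre (i, j) t) (s.post (i, j) t))
      (Finset.mem_univ j)
    simpa [placeGcd, h.1, h.2, Pi.single_eq_of_ne hij.symm] using this
  exact Nat.eq_one_of_dvd_coprimes (Nat.coprime_div_gcd_div_gcd hg) hj hi

theorem IsMarked.setMarking {s : Memory m} {a b : Fin m} (h : s.IsMarked a b)
    {p : Fin m × Fin m} (hp : (a, b) ≠ p) (k : ℕ) : (s.setMarking p k).IsMarked a b := by
  simpa only [IsMarked, Memory.setMarking, Function.update_of_ne hp] using h

theorem isMarked_setMarking_out (s : Memory m) {i h : Fin m} (hi : h < i) :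
    (s.setMarking (i, h) (s.pre (i, h) h)).IsMarked i h := by
  simp [IsMarked, setMarking, hi.not_gt]

theorem isMarked_setMarking_in {Υ : Fin m → ℕ} (hsupp : ∀ t, 0 < Υ t) {s : Memory m}
    {i h : Fin m} (hi : h < i) (hs : s.HasWeights Υ h i) :
    (s.setMarking (h, i) (s.pre (h, i) i - s.placeGcd (h, i))).IsMarked h i := by
  -- Positivity of the weight makes the truncated subtraction exact.
  have hpre : 0 < s.pre (h, i) i := by
    rw [hs.1, Pi.single_eq_same]
    exact Nat.div_pos (Nat.gcd_le_left _ (hsupp h)) (Nat.gcd_pos_of_pos_left _ (hsupp h))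
  simp only [IsMarked, setMarking, Function.update_self,
    placeGcd_of_hasWeights hi.ne (hsupp h) hs]
  exact ⟨fun h' => absurd h' hi.not_gt, fun _ => Nat.sub_add_cancel hpre⟩

end Memory

open Memory

/-- The invariant of the algorithm at each of its control points. -/
def Control.Invariant (Υ : Fin m → ℕ) : Control m → Memory m → Prop
  | .build todo, s =>
      (∀ i j, (i, j) ∈ todo → i < j) ∧
      (∀ i j, (i, j) ∈ s.places ↔ i ≠ j ∧ (i, j) ∉ todo ∧ (j, i) ∉ todo) ∧
      ∀ i j, (i, j) ∈ s.places → s.HasWeights Υ i j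
  | .head k, s => s.IsBuilt Υ ∧ ∀ a b : Fin m, a ≠ b → (a : ℕ) < k → (b : ℕ) < k → s.IsMarked a b
  | .markOut i todo, s => s.IsBuilt Υ ∧ (∀ a b, a ≠ b → a < i → b < i → s.IsMarked a b) ∧
      (∀ h ∈ todo, h < i) ∧ ∀ h < i, h ∉ todo → s.IsMarked i h
  | .markIn i todo, s => s.IsBuilt Υ ∧ (∀ a b, a ≠ b → a < i → b < i → s.IsMarked a b) ∧
      (∀ h < i, s.IsMarked i h) ∧ (∀ h ∈ todo, h < i) ∧ ∀ h < i, h ∉ todo → s.IsMarked h i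
  | .done, s => s.IsBuilt Υ ∧ ∀ a b, a ≠ b → s.IsMarked a b

theorem invariant_start (Υ : Fin m → ℕ) : (start m).1.Invariant Υ (start m).2 := by
  refine ⟨by simp, fun i j => ?_, by simp [start, Memory.empty]⟩
  simp only [start, Memory.empty, Finset.notMem_empty, Finset.mem_filter, Finset.mem_univ,
    true_and, false_iff]
  omega

/-- An assignment made while treating `i` only touches a place with `i` as an index, so it cannot
spoil the places between smaller indices. -/
theorem Step.invariant {Υ : Fin m → ℕ} (hsupp : ∀ t, 0 < Υ t) {c c' : Control m × Memory m}
    (h : Step Υ c c') (hc : c.1.Invariant Υ c.2) : c'.1.Invariant Υ c'.2 := by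
  cases h with
  | @addPair todo i j s h =>
    obtain ⟨hlt, hpl, hw⟩ := hc
    have hij := hlt i j h
    refine ⟨fun a b hab => hlt a b (Finset.mem_of_mem_erase hab), fun a b => ?_,
      fun a b hab => ?_⟩
    · simp only [addCircuit, Finset.mem_insert, hpl, Finset.mem_erase, Prod.mk.injEq, ne_eq]
      by_cases h1 : a = i ∧ b = j
      · obtain ⟨rfl, rfl⟩ := h1
        -- The pairs still to be visited are increasing, so the reversed pair is not among them.
        simpa [hij.ne, hij.ne'] using fun h' => hij.not_gt (hlt _ _ h')
      · by_cases h2 : a = j ∧ b = i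
        · obtain ⟨rfl, rfl⟩ := h2
          simpa [hij.ne, hij.ne'] using fun h' => hij.not_gt (hlt _ _ h')
        · have h2' : ¬ (b = i ∧ a = j) := fun h => h2 h.symm
          simp [h1, h2, h2']
    · by_cases h1 : (a, b) = (i, j)
      · obtain ⟨rfl, rfl⟩ := Prod.mk.inj h1
        exact (hasWeights_addCircuit Υ s hij.ne).1
      · by_cases h2 : (a, b) = (j, i)
        · obtain ⟨rfl, rfl⟩ := Prod.mk.inj h2
          exact (hasWeights_addCircuit Υ s hij.ne).2
        · refine (hw a b ?_).addCircuit h1 h2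
          simpa [addCircuit, h1, h2] using hab
  | endBuild =>
    obtain ⟨-, hpl, hw⟩ := hc
    have hpl' : ∀ i j, (i, j) ∈ _ ↔ i ≠ j := fun i j => by simpa using hpl i j
    refine ⟨⟨hpl', fun i j hij => hw i j ((hpl' i j).2 hij)⟩, fun a b hab ha hb => ?_⟩
    -- The counter starts at `1`, so two indices below it coincide.
    exact absurd (Fin.ext (by omega)) hab
  | enter hi =>
    obtain ⟨hb, hm⟩ := hc
    exact ⟨hb, fun a b hab ha hb => hm a b hab ha hb, by simp, by simp_all⟩
  | @markOutput i h todo s hh =>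
    obtain ⟨hb, hm, hlt, ho⟩ := hc
    refine ⟨hb, fun a b hab ha hb => (hm a b hab ha hb).setMarking ?_ _,
      fun a ha => hlt a (Finset.mem_of_mem_erase ha), fun a ha hna => ?_⟩
    · rintro ⟨⟩
      exact lt_irrefl _ ha
    · by_cases hah : a = h
      · subst hah
        exact isMarked_setMarking_out s ha
      · exact (ho a ha fun h' => hna (Finset.mem_erase.2 ⟨hah, h'⟩)).setMarking
          (fun h' => hah (congrArg Prod.snd h')) _
  | endOutputs =>
    obtain ⟨hb, hm, -, ho⟩ := hc
    exact ⟨hb, hm, fun h hh => ho h hh (Finset.notMem_empty h), by simp, by simp_all⟩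
  | @markInput i h todo s hh =>
    obtain ⟨hb, hm, ho, hlt, hin⟩ := hc
    have hhi := hlt h hh
    refine ⟨hb, fun a b hab ha hb => (hm a b hab ha hb).setMarking ?_ _,
      fun a ha => (ho a ha).setMarking ?_ _,
      fun a ha => hlt a (Finset.mem_of_mem_erase ha), fun a ha hna => ?_⟩
    · rintro ⟨⟩
      exact lt_irrefl _ hb
    · rintro ⟨⟩
      exact lt_irrefl _ hhi
    · by_cases hah : a = h
      · subst hah
        exact isMarked_setMarking_in hsupp ha (hb.2 _ _ ha.ne)
      · exact (hin a ha fun h' => hna (Finset.mem_erase.2 ⟨hah, h'⟩)).setMarking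
          (fun h' => hah (congrArg Prod.fst h')) _
  | @endInputs i s =>
    obtain ⟨hb, hm, ho, -, hin⟩ := hc
    refine ⟨hb, fun a b hab ha hb => ?_⟩
    rcases Nat.lt_succ_iff_lt_or_eq.1 ha with ha' | ha'
    · rcases Nat.lt_succ_iff_lt_or_eq.1 hb with hb' | hb'
      · exact hm a b hab ha' hb'
      · obtain rfl := Fin.ext hb'
        exact hin a ha' (Finset.notMem_empty a)
    · obtain rfl := Fin.ext ha'
      rcases Nat.lt_succ_iff_lt_or_eq.1 hb with hb' | hb'
      · exact ho b hb'
      · exact absurd (Fin.ext hb').symm hab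
  | exit hi =>
    obtain ⟨hb, hm⟩ := hc
    exact ⟨hb, fun a b hab => hm a b hab (a.2.trans_le hi) (b.2.trans_le hi)⟩

theorem Returns.isCompleteNet {Υ : Fin m → ℕ} (hsupp : ∀ t, 0 < Υ t) {s : Memory m}
    (h : Returns Υ s) : IsCompleteNet Υ s := by
  have key : ∀ c, Relation.ReflTransGen (Step Υ) (start m) c → c.1.Invariant Υ c.2 := by
    intro c hc
    induction hc with
    | refl => exact invariant_start Υ
    | tail _ hstep ih => exact hstep.invariant hsupp ih
  obtain ⟨⟨hpl, hw⟩, hm⟩ := key _ h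
  refine ⟨hpl, fun i j hij => ⟨fun t => ?_, fun t => ?_, hm i j hij⟩⟩
  · rw [(hw i j hij).1, Pi.single_apply]
  · rw [(hw i j hij).2, Pi.single_apply]

end WeakSynthesis

/-! ### State equation and reachability graph of a net -/

namespace WeakSynthesis

namespace PetriSystem

variable {P T : Type} {N : PetriSystem P T}

/-- The state equation, with consumption moved to the left to avoid subtraction in `ℕ`. -/
theorem add_sum_pre_eq {M M' : P → ℕ} {σ : List T} (h : N.markingLTS.Path M σ M') (p : P) :
    M' p + (σ.map (N.pre p)).sum = M p + (σ.map (N.post p)).sum := by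
  induction h with
  | nil => rfl
  | snoc _ htr ih =>
    have h1 := htr.1 p
    have h2 := htr.2 p
    simp only [List.map_append, List.map_cons, List.map_nil, List.sum_append, List.sum_cons,
      List.sum_nil]
    omega

theorem path_of_path_reachabilityGraph {A B : {M : P → ℕ // N.ReachableFrom N.M₀ M}}
    {σ : List T} (h : N.reachabilityGraph.Path A σ B) : N.markingLTS.Path A.1 σ B.1 := by
  induction h with
  | nil => exact .nil _
  | snoc _ htr ih => exact ih.snoc htr

theorem reachable_reachabilityGraph (A : {M : P → ℕ // N.ReachableFrom N.M₀ M}) :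
    N.reachabilityGraph.Reachable N.reachabilityGraph.init A := by
  have key : ∀ σ M', N.markingLTS.Path N.M₀ σ M' → ∀ h : N.ReachableFrom N.M₀ M',
      N.reachabilityGraph.Path N.reachabilityGraph.init σ ⟨M', h⟩ := by
    intro σ M' hp
    induction hp with
    | nil => exact fun _ => .nil _
    | snoc hp htr ih =>
      intro h
      have h' := ih ⟨_, hp⟩
      exact h'.snoc htr
  obtain ⟨M, σ, h⟩ := A
  exact ⟨σ, key _ _ h _⟩

/-- If every reachable marking enables exactly one transition, then the reachability graph is
deterministic. -/
theorem exists_isDeterminedBy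
    (h : ∀ M, N.ReachableFrom N.M₀ M → ∃! t, N.Enabled M t) :
    ∃ l f, N.reachabilityGraph.IsDeterminedBy l f ∧ ∀ A, N.Enabled A.1 (l A) := by
  have key : ∀ A : {M : P → ℕ // N.ReachableFrom N.M₀ M}, ∃ t A',
      (∀ t' A'', N.reachabilityGraph.tr A t' A'' ↔ t' = t ∧ A'' = A') ∧ N.Enabled A.1 t := by
    rintro ⟨M, hM⟩
    obtain ⟨t, ht, hu⟩ := h M hM
    have hf : N.Fires M t (fun p => M p - N.pre p t + N.post p t) := ⟨ht, fun _ => rfl⟩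
    refine ⟨t, ⟨_, hM.choose ++ [t], hM.choose_spec.snoc hf⟩, ?_, ht⟩
    rintro t' ⟨M'', hM''⟩
    constructor
    · intro htr
      obtain rfl := hu t' htr.1
      exact ⟨rfl, Subtype.ext (funext htr.2)⟩
    · rintro ⟨rfl, h2⟩
      cases h2
      exact hf
  choose l f hf hl using key
  exact ⟨l, f, hf, hl⟩

end PetriSystem

theorem sum_map_eq_count_mul {T : Type} [DecidableEq T] (σ : List T) {g : T → ℕ} {a : T} {k : ℕ}
    (hg : ∀ t, g t = if t = a then k else 0) : (σ.map g).sum = σ.count a * k := by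
  induction σ with
  | nil => simp
  | cons t σ ih =>
    rw [List.map_cons, List.sum_cons, ih, hg, List.count_cons]
    by_cases h : t = a <;> simp [h, add_mul, add_comm]

theorem sum_count_eq_length {T : Type} [DecidableEq T] [Fintype T] (σ : List T) :
    ∑ t, σ.count t = σ.length := by
  induction σ with
  | nil => simp
  | cons a σ ih => simp [List.count_cons, Finset.sum_add_distrib, ih]

/-! ### Dynamics of the complete net of binary circuits -/

namespace IsCompleteNet

variable {m : ℕ} {Υ : Fin m → ℕ} {s : Memory m}

theorem isWMG (hs : IsCompleteNet Υ s) : s.toSystem.IsWMG := by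
  rintro ⟨⟨i, j⟩, hp⟩
  obtain ⟨hpre, hpost, -⟩ := hs.2 i j ((hs.1 i j).1 hp)
  refine ⟨Set.encard_le_one_iff.2 fun a b ha hb => ?_,
    Set.encard_le_one_iff.2 fun a b ha hb => ?_⟩
  · simp only [Memory.toSystem, hpre, Set.mem_ofPred_eq] at ha hb
    have h1 : a = j := by by_contra h; simp [h] at ha
    have h2 : b = j := by by_contra h; simp [h] at hb
    rw [h1, h2]
  · simp only [Memory.toSystem, hpost, Set.mem_ofPred_eq] at ha hb
    have h1 : a = i := by by_contra h; simp [h] at ha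
    have h2 : b = i := by by_contra h; simp [h] at hb
    rw [h1, h2]

theorem state_equation (hs : IsCompleteNet Υ s) {M M' : s.places → ℕ} {σ : List (Fin m)}
    (h : s.toSystem.markingLTS.Path M σ M') {i j : Fin m} (hp : (i, j) ∈ s.places) :
    M' ⟨(i, j), hp⟩ + σ.count j * (Υ i / Nat.gcd (Υ i) (Υ j)) =
      M ⟨(i, j), hp⟩ + σ.count i * (Υ j / Nat.gcd (Υ i) (Υ j)) := by
  obtain ⟨hpre, hpost, -⟩ := hs.2 i j ((hs.1 i j).1 hp)
  have := PetriSystem.add_sum_pre_eq h ⟨(i, j), hp⟩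
  rwa [sum_map_eq_count_mul σ (g := s.toSystem.pre ⟨(i, j), hp⟩) hpre,
    sum_map_eq_count_mul σ (g := s.toSystem.post ⟨(i, j), hp⟩) hpost] at this

/-- After the firing sequence `σ`, the enabled transition is the one of least index among those
with the least ratio `σ.count t / Υ t`. -/
theorem enabled_iff (hs : IsCompleteNet Υ s) (hsupp : ∀ t, 0 < Υ t) {M : s.places → ℕ}
    {σ : List (Fin m)} (h : s.toSystem.markingLTS.Path s.toSystem.M₀ σ M) (j : Fin m) :
    s.toSystem.Enabled M j ↔ ∀ i, (j < i → σ.count j * Υ i ≤ σ.count i * Υ j) ∧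
      (i < j → σ.count j * Υ i < σ.count i * Υ j) := by
  -- The state equation turns enabledness at one place into a comparison of counts, scaled by the
  -- gcd; the missing token makes it strict when `i < j`.
  have hplace : ∀ i (hij : i ≠ j), s.pre (i, j) j ≤ M ⟨(i, j), (hs.1 i j).2 hij⟩ ↔
      (j < i → σ.count j * Υ i ≤ σ.count i * Υ j) ∧
      (i < j → σ.count j * Υ i < σ.count i * Υ j) := by
    intro i hij
    obtain ⟨hpre, -, hgt, hlt⟩ := hs.2 i j hij
    have hst := hs.state_equation h ((hs.1 i j).2 hij)
    have hg : 0 < Nat.gcd (Υ i) (Υ j) := Nat.gcd_pos_of_pos_left _ (hsupp i)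
    have hi : Υ i = Υ i / Nat.gcd (Υ i) (Υ j) * Nat.gcd (Υ i) (Υ j) :=
      (Nat.div_mul_cancel (Nat.gcd_dvd_left _ _)).symm
    have hj : Υ j = Υ j / Nat.gcd (Υ i) (Υ j) * Nat.gcd (Υ i) (Υ j) :=
      (Nat.div_mul_cancel (Nat.gcd_dvd_right _ _)).symm
    have hprej := hpre j
    rw [if_pos rfl] at hprej
    change _ = s.marking (i, j) + _ at hst
    rw [hprej] at hgt hlt ⊢
    generalize Nat.gcd (Υ i) (Υ j) = g at *
    generalize Υ i / g = a at *
    generalize Υ j / g = b at *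
    rw [hi, hj, ← mul_assoc, ← mul_assoc, Nat.mul_le_mul_right_iff hg,
      Nat.mul_lt_mul_right hg]
    rcases lt_or_gt_of_ne hij with h' | h'
    · have := hlt h'
      simp only [h', h'.not_gt, false_imp_iff, true_imp_iff, true_and]
      omega
    · have := hgt h'
      simp only [h', h'.not_gt, false_imp_iff, true_imp_iff, and_true]
      omega
  constructor
  · intro hen i
    by_cases hij : i = j
    · subst hij; simp
    · exact (hplace i hij).1 (hen ⟨(i, j), (hs.1 i j).2 hij⟩)
  · rintro hall ⟨⟨i, k⟩, hp⟩
    have hik := (hs.1 i k).1 hp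
    by_cases hkj : j = k
    · subst hkj
      exact (hplace i hik).2 (hall i)
    · have : s.pre (i, k) j = 0 := by rw [(hs.2 i k hik).1, if_neg hkj]
      exact this.le.trans (Nat.zero_le _)

theorem existsUnique_enabled (hs : IsCompleteNet Υ s) (hsupp : ∀ t, 0 < Υ t)
    [Nonempty (Fin m)] {M : s.places → ℕ}
    (h : s.toSystem.ReachableFrom s.toSystem.M₀ M) : ∃! t, s.toSystem.Enabled M t := by
  obtain ⟨σ, h⟩ := h
  -- The lexicographic order on (ratio, index) is the cross-multiplied criterion of `enabled_iff`.
  obtain ⟨j, hj⟩ := Finite.exists_min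
    fun t : Fin m => toLex ((σ.count t : ℚ) / (Υ t : ℚ), t)
  have hpos : ∀ t, (0 : ℚ) < Υ t := fun t => by exact_mod_cast hsupp t
  refine ⟨j, (hs.enabled_iff hsupp h j).2 fun i => ?_, fun j' hj' => ?_⟩
  · have hle := Prod.Lex.toLex_le_toLex.1 (hj i)
    simp only [div_lt_div_iff₀ (hpos j) (hpos i), div_eq_div_iff (hpos j).ne' (hpos i).ne'] at hle
    norm_cast at hle
    constructor
    · intro _
      rcases hle with h1 | h1
      · exact h1.le
      · exact h1.1.le
    · intro hij
      rcases hle with h1 | h1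
      · exact h1
      · exact absurd h1.2 hij.not_ge
  · replace hj' := (hs.enabled_iff hsupp h j').1 hj'
    have hle := Prod.Lex.toLex_le_toLex.1 (hj j')
    simp only [div_lt_div_iff₀ (hpos j) (hpos j'),
      div_eq_div_iff (hpos j).ne' (hpos j').ne'] at hle
    norm_cast at hle
    obtain ⟨h1, h2⟩ := hj' j
    rcases lt_trichotomy j' j with hlt | heq | hgt
    · have := h1 hlt
      rcases hle with h3 | h3
      · exact absurd this h3.not_ge
      · exact absurd h3.2 hlt.not_ge
    · exact heq
    · have := h2 hgt
      rcases hle with h3 | h3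
      · exact absurd this h3.not_gt
      · exact absurd h3.1 this.ne'

/-- While fewer than `∑ t, Υ t` steps have been made, some `i` has ratio below one, so a transition
`u` that already fired `Υ u` times has a larger ratio and is not enabled. -/
theorem count_le (hs : IsCompleteNet Υ s) (hsupp : ∀ t, 0 < Υ t) {M : s.places → ℕ}
    {σ : List (Fin m)} (h : s.toSystem.markingLTS.Path s.toSystem.M₀ σ M)
    (hlen : σ.length ≤ ∑ t, Υ t) (t : Fin m) : σ.count t ≤ Υ t := by
  induction h generalizing t with
  | nil => simp
  | @snoc M₁ M₂ σ u hp htr ih =>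
    rw [List.length_append, List.length_singleton] at hlen
    have ih' := ih (by omega)
    rw [List.count_append, List.count_singleton]
    by_cases hut : u = t
    · subst hut
      obtain ⟨i, -, hi⟩ := Finset.exists_lt_of_sum_lt
        (by rw [sum_count_eq_length]; exact hlen : ∑ t, σ.count t < ∑ t, Υ t)
      have hu : σ.count u < Υ u := by
        rcases (ih' u).lt_or_eq with h1 | h1
        · exact h1
        · have hiu : i ≠ u := by rintro rfl; exact hi.ne h1
          obtain ⟨h2, h3⟩ := (hs.enabled_iff hsupp hp u).1 htr.1 i
          have h4 : σ.count u * Υ i ≤ σ.count i * Υ u := by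
            rcases lt_or_gt_of_ne hiu with h' | h'
            · exact (h3 h').le
            · exact h2 h'
          rw [h1, mul_comm] at h4
          exact absurd (Nat.le_of_mul_le_mul_right h4 (hsupp u)) hi.not_ge
      simpa using hu
    · simpa [hut] using ih' t

theorem count_eq (hs : IsCompleteNet Υ s) (hsupp : ∀ t, 0 < Υ t) {M : s.places → ℕ}
    {σ : List (Fin m)} (h : s.toSystem.markingLTS.Path s.toSystem.M₀ σ M)
    (hlen : σ.length = ∑ t, Υ t) (t : Fin m) : σ.count t = Υ t :=
  (Finset.sum_eq_sum_iff_of_le fun t _ => hs.count_le hsupp h hlen.le t).1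
    (by rw [sum_count_eq_length, hlen]) t (Finset.mem_univ t)

theorem marking_eq_of_length_eq (hs : IsCompleteNet Υ s) (hsupp : ∀ t, 0 < Υ t)
    {M : s.places → ℕ} {σ : List (Fin m)}
    (h : s.toSystem.markingLTS.Path s.toSystem.M₀ σ M) (hlen : σ.length = ∑ t, Υ t) :
    M = s.toSystem.M₀ := by
  funext ⟨⟨i, j⟩, hp⟩
  have hst := hs.state_equation h hp
  rw [hs.count_eq hsupp h hlen, hs.count_eq hsupp h hlen,
    ← Nat.mul_div_assoc _ (Nat.gcd_dvd_left _ _), ← Nat.mul_div_assoc _ (Nat.gcd_dvd_right _ _),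
    mul_comm (Υ j)] at hst
  exact Nat.add_right_cancel hst

/-- Summing the proportionality `σ.count j * Υ i = σ.count i * Υ j` over `i` shows that the sum
divides `σ.length * Υ j` for every `j`, hence also the gcd of these products, which is `σ.length`.
-/
theorem sum_dvd_length (hs : IsCompleteNet Υ s) (hprime : IsPrimeVector Υ)
    {σ : List (Fin m)}
    (h : s.toSystem.markingLTS.Path s.toSystem.M₀ σ s.toSystem.M₀) :
    ∑ t, Υ t ∣ σ.length := by
  have hprop : ∀ i j, σ.count j * Υ i = σ.count i * Υ j := by
    intro i j
    by_cases hij : i = j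
    · subst hij; rfl
    · have hst := Nat.add_left_cancel (hs.state_equation h ((hs.1 i j).2 hij))
      have hi := Nat.div_mul_cancel (Nat.gcd_dvd_left (Υ i) (Υ j))
      have hj := Nat.div_mul_cancel (Nat.gcd_dvd_right (Υ i) (Υ j))
      calc σ.count j * Υ i
          = σ.count j * (Υ i / Nat.gcd (Υ i) (Υ j)) * Nat.gcd (Υ i) (Υ j) := by
            rw [mul_assoc, hi]
        _ = σ.count i * Υ j := by rw [hst, mul_assoc, hj]
  have hdvd : ∑ t, Υ t ∣ Finset.univ.gcd fun j => σ.length * Υ j := by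
    refine Finset.dvd_gcd fun j _ => ⟨σ.count j, ?_⟩
    rw [← sum_count_eq_length, Finset.sum_mul, Finset.sum_mul]
    exact Finset.sum_congr rfl fun i _ => by rw [← hprop, mul_comm]
  have hgcd : Finset.univ.gcd Υ = 1 := hprime
  rwa [Finset.gcd_mul_left, hgcd, mul_one, normalize_eq] at hdvd

end IsCompleteNet

end WeakSynthesis

open WeakSynthesis in
theorem mainTheorem4 (m : ℕ) (Υ : Fin m → ℕ)
    (hsupp : ∀ t, 0 < Υ t) (hprime : WeakSynthesis.IsPrimeVector Υ) :
    WeakSynthesis.Terminates Υ ∧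
    ∀ s : WeakSynthesis.Memory m, WeakSynthesis.Returns Υ s →
      WeakSynthesis.IsCompleteNet Υ s ∧
      s.toSystem.IsWMG ∧
      s.toSystem.Live ∧
      (∀ M, s.toSystem.ReachableFrom s.toSystem.M₀ M → ∃! t, s.toSystem.Enabled M t) ∧
      s.toSystem.reachabilityGraph.IsCircular ∧
      ∃ (w : List (Fin m)) (hw : w ≠ []),
        WeakSynthesis.parikh w = Υ ∧ s.toSystem.CyclicallySolves w hw := by
  refine ⟨terminates Υ, fun s hret => ?_⟩
  have hs := hret.isCompleteNet hsupp
  have hne : Nonempty (Fin m) := by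
    by_contra hempty
    rw [not_nonempty_iff] at hempty
    -- The gcd of the empty family is zero, so primality excludes `m = 0`.
    simp [IsPrimeVector, Finset.univ_eq_empty] at hprime
  have huniq : ∀ M, s.toSystem.ReachableFrom s.toSystem.M₀ M → ∃! t, s.toSystem.Enabled M t :=
    fun M hM => hs.existsUnique_enabled hsupp hM
  obtain ⟨l, f, hdet, hl⟩ := PetriSystem.exists_isDeterminedBy huniq
  have hreach := PetriSystem.reachable_reachabilityGraph (N := s.toSystem)
  have htrace : ∀ n, s.toSystem.markingLTS.Path s.toSystem.M₀
      (LTS.trace l f s.toSystem.reachabilityGraph.init n)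
      (f^[n] s.toSystem.reachabilityGraph.init).1 := fun n =>
    PetriSystem.path_of_path_reachabilityGraph (hdet.path_trace s.toSystem.reachabilityGraph.init n)
  have hsum : 0 < ∑ t, Υ t := Finset.sum_pos (fun t _ => hsupp t) Finset.univ_nonempty
  have hperiod : Function.minimalPeriod f s.toSystem.reachabilityGraph.init = ∑ t, Υ t := by
    refine Nat.dvd_antisymm (Function.IsPeriodicPt.minimalPeriod_dvd ?_) ?_
    · exact Subtype.ext (hs.marking_eq_of_length_eq hsupp (htrace _) (LTS.length_trace _ _ _ _))
    · have h1 := htrace (Function.minimalPeriod f s.toSystem.reachabilityGraph.init)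
      rw [Function.iterate_minimalPeriod] at h1
      simpa using hs.sum_dvd_length hprime h1
  have hpos : 0 < Function.minimalPeriod f s.toSystem.reachabilityGraph.init := hperiod ▸ hsum
  have hcount : ∀ t, (LTS.trace l f s.toSystem.reachabilityGraph.init (∑ t, Υ t)).count t = Υ t :=
    hs.count_eq hsupp (htrace _) (LTS.length_trace _ _ _ _)
  have hw : LTS.trace l f s.toSystem.reachabilityGraph.init (∑ t, Υ t) ≠ [] := by
    rw [← List.length_pos_iff, LTS.length_trace]
    exact hsum
  refine ⟨hs, hs.isWMG, fun M hM t => ?_, huniq, hdet.isCircular hreach hpos, _, hw,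
    funext hcount, hdet.isomorphic_circularLTS hreach hperiod hw⟩
  -- Liveness: `t` labels some arc of the circle, and the source of that arc is reachable from any
  -- state.
  have hmem : t ∈ LTS.trace l f s.toSystem.reachabilityGraph.init (∑ t, Υ t) :=
    List.count_pos_iff.1 (hcount t ▸ hsupp t)
  obtain ⟨k, -, hk⟩ := List.mem_map.1 hmem
  obtain ⟨σ, hσ⟩ := hdet.reachable_of_pos hreach hpos ⟨M, hM⟩
    (f^[k] s.toSystem.reachabilityGraph.init)
  exact ⟨_, ⟨σ, PetriSystem.path_of_path_reachabilityGraph hσ⟩, hk ▸ hl _⟩
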